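/- Let $d\ge 2$ be an integer. A standard $d$-adic interval is an interval $[a/d^k,(a+1)/d^k)$ with integers $k\ge 0$, $0\le a\le d^k-1$; a standard $d$-adic partition is a sequence $0=x_0<x_1<\dots<x_n=1$ such that every $[x_i,x_{i+1})$ is a standard $d$-adic interval. Let $V_d$ be the Higman–Thompson group of all bijections $g$ of $[0,1)$ for which there is a standard $d$-adic partition such that on each of its intervals $[x_i,x_{i+1})$ the map $g$ is affine with image a standard $d$-adic interval, and let $T_d\le V_d$ be the subgroup of those elements that preserve the cyclic order of $[0,1)$ (viewed as a circle). For $G\in\{V_d,T_d\}$ let $G_{[0,1/d)}$, respectively $G_{[1/d,1]}$, be the subgroup of the elements of $G$ that act as the identity on $[0,1/d)$, respectively on $[1/d,1)$ (the point $1$ being identified with $0$ on the circle, so not an additional condition). For a subgroup $H$ of a group $G$ let $$\mathcal C_G(H)=\{g\in G: h^{-1}gh=g\ \text{for all } h\in H\},\qquad \mathcal{VC}_G(H)=\{g\in G: |\{h^{-1}gh: h\in H\}|<\infty\}$$ be the centralizer and the virtual centralizer of $H$ in $G$. Let $\lambda$ be the left regular representation of $G$ on $\ell^2(G)$, $L(G)=\{\lambda_g: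 g\in G\}''\subseteq\mathcal B(\ell^2(G))$ the group von Neumann algebra, and $L(H)=\{\lambda_h: h\in H\}''\subseteq L(G)$ for $H\le G$. Then: 1. $\mathcal{VC}_{V_d}(V_{[0,1/d)})=\mathcal C_{V_d}(V_{[0,1/d)})=V_{[1/d,1]}$; 2. $\mathcal{VC}_{V_d}(V_{[1/d,1]})=\mathcal C_{V_d}(V_{[1/d,1]})=V_{[0,1/d)}$; 3. $\mathcal{VC}_{T_d}(T_{[0,1/d)})=\mathcal C_{T_d}(T_{[0,1/d)})=T_{[1/d,1]}$; 4. $\mathcal{VC}_{T_d}(T_{[1/d,1]})=\mathcal C_{T_d}(T_{[1/d,1]})=T_{[0,1/d)}$. In particular, $$(L(V_{[0,1/d)})'\cap L(V_d))'\cap L(V_d)=L(V_{[0,1/d)})\quad\text{and}\quad (L(T_{[0,1/d)})'\cap L(T_d))'\cap L(T_d)=L(T_{[0,1/d)}),$$ that is, $L(V_{[0,1/d)})$ is bicentralized in $L(V_d)$ and $L(T_{[0,1/d)})$ is bicentralized in $L(T_d)$. -/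

import Mathlib

noncomputable section

namespace HigmanThompson

/-! ### The groups `V_d` and `T_d` as groups of bijections of `[0, 1)` -/

/-- The half-open unit interval `[0, 1)`. -/
abbrev UnitIco : Type := Set.Ico (0 : ℝ) 1

/-- The interval `[a / d ^ k, (a + 1) / d ^ k)`. -/
def cell (d k a : ℕ) : Set ℝ := Set.Ico ((a : ℝ) / (d : ℝ) ^ k) (((a : ℝ) + 1) / (d : ℝ) ^ k)

/-- A (half-open) standard `d`-adic interval: `[a / d ^ k, (a + 1) / d ^ k)` with
`0 ≤ a ≤ d ^ k - 1`. -/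
def IsStandardInterval (d : ℕ) (I : Set ℝ) : Prop :=
  ∃ k a : ℕ, a < d ^ k ∧ I = cell d k a

/-- A standard `d`-adic partition `0 = x₀ < x₁ < ⋯ < xₙ = 1`: every `[xᵢ, xᵢ₊₁)` is a standard
`d`-adic interval. -/
def IsStandardPartition (d n : ℕ) (x : Fin (n + 1) → ℝ) : Prop :=
  StrictMono x ∧ x 0 = 0 ∧ x (Fin.last n) = 1 ∧
    ∀ i : Fin n, IsStandardInterval d (Set.Ico (x i.castSucc) (x i.succ))

/-- On the interval `I` the map `g` is given by a standard affine map: an affine map that takes `I`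
onto a standard `d`-adic interval. -/
def IsStandardAffineOn (d : ℕ) (g : UnitIco → UnitIco) (I : Set ℝ) : Prop :=
  ∃ α β : ℝ, (∀ x : UnitIco, (x : ℝ) ∈ I → (g x : ℝ) = α * x + β) ∧
    IsStandardInterval d ((fun t : ℝ => α * t + β) '' I)

/-- The bijections of `[0, 1)` that are standard affine on each interval of some standard `d`-adic
partition. -/
def IsPiecewiseStandardAffine (d : ℕ) (g : Equiv.Perm UnitIco) : Prop :=
  ∃ (n : ℕ) (x : Fin (n + 1) → ℝ), IsStandardPartition d n x ∧
    ∀ i : Fin n, IsStandardAffineOn d g (Set.Ico (x i.castSucc) (x i.succ))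

/-- `g` maps the `a`-th interval of level `k` onto the `b`-th interval of level `l`, by the
increasing affine map. -/
def MapsCell (d : ℕ) (g : UnitIco → UnitIco) (k a l b : ℕ) : Prop :=
  ∀ x : UnitIco, (x : ℝ) ∈ cell d k a → (g x : ℝ) * (d : ℝ) ^ l - b = (x : ℝ) * (d : ℝ) ^ k - a

theorem mem_cell {d : ℕ} [NeZero d] {k a : ℕ} {x : ℝ} :
    x ∈ cell d k a ↔ 0 ≤ x * (d : ℝ) ^ k - a ∧ x * (d : ℝ) ^ k - a < 1 := by
  have hd : (0 : ℝ) < (d : ℝ) ^ k := pow_pos (Nat.cast_pos.2 (NeZero.pos d)) k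
  rw [cell, Set.mem_Ico, div_le_iff₀ hd, lt_div_iff₀ hd]
  constructor <;> rintro ⟨h1, h2⟩ <;> constructor <;> linarith

theorem cell_subset {d : ℕ} [NeZero d] {k a : ℕ} (ha : a < d ^ k) {x : ℝ}
    (hx : x ∈ cell d k a) : 0 ≤ x ∧ x < 1 := by
  have hd : (0 : ℝ) < (d : ℝ) ^ k := pow_pos (Nat.cast_pos.2 (NeZero.pos d)) k
  rw [mem_cell] at hx
  have ha' : (a : ℝ) + 1 ≤ (d : ℝ) ^ k := by exact_mod_cast ha
  have ha0 : (0 : ℝ) ≤ a := Nat.cast_nonneg a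
  constructor
  · by_contra h
    nlinarith
  · by_contra h
    nlinarith

/-- The `j`-th subinterval, `n` levels deeper. -/
theorem mem_cell_sub {d : ℕ} [NeZero d] {k a n j : ℕ} (hj : j < d ^ n) {x : ℝ}
    (hx : x ∈ cell d (k + n) (a * d ^ n + j)) : x ∈ cell d k a := by
  have hd : (0 : ℝ) < (d : ℝ) ^ n := pow_pos (Nat.cast_pos.2 (NeZero.pos d)) n
  rw [mem_cell] at hx ⊢
  push_cast [pow_add] at hx
  have hj' : (j : ℝ) + 1 ≤ (d : ℝ) ^ n := by exact_mod_cast hj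
  have hj0 : (0 : ℝ) ≤ j := Nat.cast_nonneg j
  have e : x * ((d : ℝ) ^ k * (d : ℝ) ^ n) - (a * (d : ℝ) ^ n + j)
      = (x * (d : ℝ) ^ k - a) * (d : ℝ) ^ n - j := by ring
  rw [e] at hx
  constructor
  · by_contra h
    nlinarith
  · by_contra h
    nlinarith

theorem MapsCell.sub {d : ℕ} [NeZero d] {g : UnitIco → UnitIco} {k a l b n j : ℕ}
    (h : MapsCell d g k a l b) (hj : j < d ^ n) :
    MapsCell d g (k + n) (a * d ^ n + j) (l + n) (b * d ^ n + j) := by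
  intro x hx
  have := h x (mem_cell_sub hj hx)
  push_cast [pow_add]
  linear_combination (d : ℝ) ^ n * this

theorem MapsCell.mem {d : ℕ} [NeZero d] {g : UnitIco → UnitIco} {k a l b : ℕ}
    (h : MapsCell d g k a l b) {x : UnitIco} (hx : (x : ℝ) ∈ cell d k a) :
    (g x : ℝ) ∈ cell d l b := by
  rw [mem_cell, h x hx, ← mem_cell]
  exact hx

theorem MapsCell.comp {d : ℕ} [NeZero d] {f g : UnitIco → UnitIco} {k a l b m c : ℕ}
    (hg : MapsCell d g k a l b) (hf : MapsCell d f l b m c) : MapsCell d (f ∘ g) k a m c :=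
  fun x hx => (hf (g x) (hg.mem hx)).trans (hg x hx)

theorem MapsCell.exists_preimage {d : ℕ} [NeZero d] {g : UnitIco → UnitIco} {k a l b : ℕ}
    (h : MapsCell d g k a l b) (ha : a < d ^ k) {y : UnitIco} (hy : (y : ℝ) ∈ cell d l b) :
    ∃ x : UnitIco, (x : ℝ) ∈ cell d k a ∧ g x = y := by
  have hd : ∀ n, (0 : ℝ) < (d : ℝ) ^ n := fun n => pow_pos (Nat.cast_pos.2 (NeZero.pos d)) n
  have e : ((y : ℝ) * (d : ℝ) ^ l - b + a) / (d : ℝ) ^ k * (d : ℝ) ^ k - a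
      = (y : ℝ) * (d : ℝ) ^ l - b := by
    rw [div_mul_cancel₀ _ (hd k).ne']; ring
  have hm : ((y : ℝ) * (d : ℝ) ^ l - b + a) / (d : ℝ) ^ k ∈ cell d k a := by
    rw [mem_cell, e, ← mem_cell]; exact hy
  refine ⟨⟨_, cell_subset ha hm⟩, hm, Subtype.ext ?_⟩
  have := h ⟨_, cell_subset ha hm⟩ hm
  rw [e] at this
  exact mul_right_cancel₀ (hd l).ne' (by linarith)

theorem MapsCell.symm {d : ℕ} [NeZero d] {g : Equiv.Perm UnitIco} {k a l b : ℕ}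
    (h : MapsCell d g k a l b) (ha : a < d ^ k) : MapsCell d g.symm l b k a := by
  intro y hy
  obtain ⟨x, hx, rfl⟩ := h.exists_preimage ha hy
  rw [Equiv.symm_apply_apply, h x hx]

theorem image_Ico_affine {p q r s α β : ℝ} (hpq : p < q) (hrs : r < s)
    (h : (fun t : ℝ => α * t + β) '' Set.Ico p q = Set.Ico r s) :
    α * p + β = r ∧ α * q + β = s := by
  have hmem : ∀ z, r ≤ z → z < s → ∃ t, p ≤ t ∧ t < q ∧ α * t + β = z := by
    intro z h1 h2
    have : z ∈ (fun t : ℝ => α * t + β) '' Set.Ico p q := by rw [h]; exact ⟨h1, h2⟩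
    obtain ⟨t, ht, e⟩ := this
    exact ⟨t, ht.1, ht.2, e⟩
  have himg : ∀ t, p ≤ t → t < q → r ≤ α * t + β ∧ α * t + β < s := by
    intro t h1 h2
    have : α * t + β ∈ Set.Ico r s := by rw [← h]; exact ⟨t, ⟨h1, h2⟩, rfl⟩
    exact this
  obtain ⟨hp1, hp2⟩ := himg p le_rfl hpq
  have hα : 0 < α := by
    by_contra hα
    obtain ⟨t, ht, -, e⟩ := hmem ((α * p + β + s) / 2) (by linarith) (by linarith)
    nlinarith
  refine ⟨?_, ?_⟩
  · obtain ⟨t, ht, -, e⟩ := hmem r le_rfl hrs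
    nlinarith
  · rcases lt_trichotomy (α * q + β) s with hlt | heq | hgt
    · obtain ⟨t, -, ht, e⟩ := hmem (α * q + β) (by nlinarith) hlt
      nlinarith
    · exact heq
    · exfalso
      have e : α * ((s - β) / α) + β = s := by field_simp; ring
      have h1 : p ≤ (s - β) / α := by rw [le_div_iff₀ hα]; linarith
      have h2 : (s - β) / α < q := by rw [div_lt_iff₀ hα]; linarith
      have := (himg _ h1 h2).2
      linarith

theorem isStandardAffineOn_cell {d : ℕ} [NeZero d] {g : UnitIco → UnitIco} {k a : ℕ} :
    IsStandardAffineOn d g (cell d k a) ↔ ∃ l b : ℕ, b < d ^ l ∧ MapsCell d g k a l b := by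
  have hd : ∀ n, (0 : ℝ) < (d : ℝ) ^ n := fun n => pow_pos (Nat.cast_pos.2 (NeZero.pos d)) n
  have hlt : ∀ n c : ℕ, (c : ℝ) / (d : ℝ) ^ n < ((c : ℝ) + 1) / (d : ℝ) ^ n := fun n c =>
    div_lt_div_of_pos_right (by linarith) (hd n)
  constructor
  · rintro ⟨α, β, hg, l, b, hb, him⟩
    obtain ⟨h1, h2⟩ := image_Ico_affine (hlt k a) (hlt l b) him
    refine ⟨l, b, hb, fun x hx => ?_⟩
    rw [hg x hx]
    have hk := (hd k).ne'
    have hl := (hd l).ne'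
    field_simp at h1 h2
    have h3 : α * (d : ℝ) ^ l = (d : ℝ) ^ k := by
      linear_combination h2 - h1
    have h4 : (d : ℝ) ^ k * (β * (d : ℝ) ^ l - b + a) = 0 := by
      linear_combination h1 - (a : ℝ) * h3
    have h5 := (mul_eq_zero.1 h4).resolve_left hk
    linear_combination (x : ℝ) * h3 + h5
  · rintro ⟨l, b, hb, h⟩
    have hk := (hd k).ne'
    have hl := (hd l).ne'
    refine ⟨(d : ℝ) ^ k / (d : ℝ) ^ l, (b - a : ℝ) / (d : ℝ) ^ l, fun x hx => ?_, l, b, hb, ?_⟩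
    · have := h x hx
      field_simp
      linarith
    · ext y
      constructor
      · rintro ⟨t, ht, rfl⟩
        rw [mem_cell] at ht ⊢
        have e : ((d : ℝ) ^ k / (d : ℝ) ^ l * t + (b - a : ℝ) / (d : ℝ) ^ l) * (d : ℝ) ^ l - b
            = t * (d : ℝ) ^ k - a := by field_simp; ring
        simpa only [e] using ht
      · intro hy
        refine ⟨(y * (d : ℝ) ^ l - b + a) / (d : ℝ) ^ k, ?_, ?_⟩
        · rw [mem_cell] at hy ⊢
          have e : (y * (d : ℝ) ^ l - b + a) / (d : ℝ) ^ k * (d : ℝ) ^ k - a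
            = y * (d : ℝ) ^ l - b := by field_simp; ring
          rwa [e]
        · field_simp
          ring

/-- The interval of level `N` that contains a given point. -/
theorem exists_cell {d : ℕ} [NeZero d] (N : ℕ) (x : UnitIco) :
    ∃ a, a < d ^ N ∧ (x : ℝ) ∈ cell d N a := by
  have hd : (0 : ℝ) < (d : ℝ) ^ N := pow_pos (Nat.cast_pos.2 (NeZero.pos d)) N
  have h0 : 0 ≤ (x : ℝ) * (d : ℝ) ^ N := mul_nonneg x.2.1 hd.le
  refine ⟨⌊(x : ℝ) * (d : ℝ) ^ N⌋₊, ?_, ?_⟩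
  · rw [Nat.floor_lt h0]
    push_cast
    have := x.2.2
    nlinarith
  · rw [mem_cell]
    have h1 := Nat.floor_le h0
    have h2 := Nat.lt_floor_add_one ((x : ℝ) * (d : ℝ) ^ N)
    constructor <;> linarith

/-- If the left end of an interval of level `k + n` lies in an interval of level `k`, then the
former is a subinterval of the latter. -/
theorem exists_sub_index {d : ℕ} [NeZero d] {k n a c : ℕ}
    (h : (c : ℝ) / (d : ℝ) ^ (k + n) ∈ cell d k a) : ∃ j, j < d ^ n ∧ c = a * d ^ n + j := by
  have hk : (0 : ℝ) < (d : ℝ) ^ k := pow_pos (Nat.cast_pos.2 (NeZero.pos d)) k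
  have hn : (0 : ℝ) < (d : ℝ) ^ n := pow_pos (Nat.cast_pos.2 (NeZero.pos d)) n
  rw [mem_cell] at h
  have e : (c : ℝ) / (d : ℝ) ^ (k + n) * (d : ℝ) ^ k = c / (d : ℝ) ^ n := by
    rw [pow_add]; field_simp
  rw [e] at h
  obtain ⟨h1, h2⟩ := h
  have h1' : (a : ℝ) ≤ c / (d : ℝ) ^ n := by linarith
  have h2' : (c : ℝ) / (d : ℝ) ^ n < a + 1 := by linarith
  rw [le_div_iff₀ hn] at h1'
  rw [div_lt_iff₀ hn] at h2'
  have h1'' : a * d ^ n ≤ c := by exact_mod_cast h1'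
  have h2'' : c < (a + 1) * d ^ n := by exact_mod_cast h2'
  refine ⟨c - a * d ^ n, ?_, by omega⟩
  rw [add_mul, one_mul] at h2''
  omega

/-- The left end of a standard interval as a point of `[0, 1)`. -/
def leftEnd {d : ℕ} {N a : ℕ} (ha : a < d ^ N) : UnitIco :=
  ⟨(a : ℝ) / (d : ℝ) ^ N, by positivity, by
    have h : (a : ℝ) < (d : ℝ) ^ N := by exact_mod_cast ha
    have h0 : (0 : ℝ) ≤ a := Nat.cast_nonneg a
    rw [div_lt_one (by linarith)]
    exact h⟩

theorem exists_piece {n : ℕ} {x : Fin (n + 1) → ℝ} {t : ℝ} (h0 : x 0 ≤ t)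
    (h1 : t < x (Fin.last n)) : ∃ i : Fin n, t ∈ Set.Ico (x i.castSucc) (x i.succ) := by
  induction n with
  | zero => exact absurd (h0.trans_lt h1) (lt_irrefl _)
  | succ n ih =>
    by_cases h : t < x (Fin.last n).castSucc
    · obtain ⟨i, hi⟩ := ih (x := fun i => x i.castSucc) h0 h
      exact ⟨i.castSucc, hi⟩
    · exact ⟨Fin.last n, not_lt.1 h, by simpa using h1⟩

/-- Partitions may be taken to be the uniform ones. -/
theorem isPiecewiseStandardAffine_iff {d : ℕ} [NeZero d] {g : Equiv.Perm UnitIco} :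
    IsPiecewiseStandardAffine d g ↔
      ∃ N, ∀ a, a < d ^ N → ∃ l b : ℕ, b < d ^ l ∧ MapsCell d g N a l b := by
  have hd : ∀ n, (0 : ℝ) < (d : ℝ) ^ n := fun n => pow_pos (Nat.cast_pos.2 (NeZero.pos d)) n
  constructor
  · rintro ⟨n, x, ⟨-, hx0, hx1, hI⟩, hg⟩
    choose k a ha e using hI
    refine ⟨Finset.univ.sup k, fun c hc => ?_⟩
    obtain ⟨i, hi⟩ := exists_piece (x := x) (t := leftEnd hc)
      (by rw [hx0]; exact (leftEnd hc).2.1) (by rw [hx1]; exact (leftEnd hc).2.2)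
    obtain ⟨m, hm⟩ := Nat.exists_eq_add_of_le (Finset.le_sup (f := k) (Finset.mem_univ i))
    have hgi := hg i
    rw [e i] at hi hgi
    obtain ⟨l, b, hb, hmap⟩ := isStandardAffineOn_cell.1 hgi
    have hi' : (c : ℝ) / (d : ℝ) ^ (k i + m) ∈ cell d (k i) (a i) := by
      rw [← hm]; exact hi
    obtain ⟨j, hj, rfl⟩ := exists_sub_index hi'
    refine ⟨l + m, b * d ^ m + j, ?_, ?_⟩
    · calc b * d ^ m + j < b * d ^ m + d ^ m := by omega
        _ = (b + 1) * d ^ m := by ring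
        _ ≤ d ^ l * d ^ m := Nat.mul_le_mul_right _ hb
        _ = d ^ (l + m) := (pow_add _ _ _).symm
    · rw [hm]; exact hmap.sub hj
  · rintro ⟨N, h⟩
    have e : ∀ i : Fin (d ^ N), Set.Ico
        ((fun i : Fin (d ^ N + 1) => ((i : ℕ) : ℝ) / (d : ℝ) ^ N) i.castSucc)
        ((fun i : Fin (d ^ N + 1) => ((i : ℕ) : ℝ) / (d : ℝ) ^ N) i.succ) = cell d N i := by
      intro i
      simp [cell]
    refine ⟨d ^ N, fun i => ((i : ℕ) : ℝ) / (d : ℝ) ^ N, ⟨?_, by simp, ?_, ?_⟩, ?_⟩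
    · intro i j hij
      exact div_lt_div_of_pos_right (by exact_mod_cast hij) (hd N)
    · simp [(hd N).ne']
    · intro i
      exact ⟨N, i, i.2, e i⟩
    · intro i
      rw [e i]
      exact isStandardAffineOn_cell.2 (h i i.2)

/-- The Higman–Thompson group `V_d`. -/
def V (d : ℕ) [NeZero d] : Subgroup (Equiv.Perm UnitIco) where
  carrier := {g | IsPiecewiseStandardAffine d g}
  one_mem' := by
    refine isPiecewiseStandardAffine_iff.2 ⟨0, fun a ha => ⟨0, a, ha, fun x _ => rfl⟩⟩
  mul_mem' := by
    intro f g hf hg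
    obtain ⟨N, hf⟩ := isPiecewiseStandardAffine_iff.1 hf
    obtain ⟨M, hg⟩ := isPiecewiseStandardAffine_iff.1 hg
    have key : ∀ m n a : ℕ, a < d ^ (m + n) → ∃ a₀ j, a₀ < d ^ m ∧ j < d ^ n ∧
        a = a₀ * d ^ n + j := by
      intro m n a ha
      have hn : 0 < d ^ n := pow_pos (NeZero.pos d) n
      refine ⟨a / d ^ n, a % d ^ n, ?_, Nat.mod_lt _ hn, (Nat.div_add_mod' a _).symm⟩
      rw [Nat.div_lt_iff_lt_mul hn, ← pow_add]
      exact ha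
    refine isPiecewiseStandardAffine_iff.2 ⟨M + N, fun a ha => ?_⟩
    obtain ⟨a₀, j, ha₀, hj, rfl⟩ := key M N a ha
    obtain ⟨l, b, hb, hmap⟩ := hg a₀ ha₀
    have hmap' := hmap.sub hj
    have hlt : b * d ^ N + j < d ^ (N + l) := by
      calc b * d ^ N + j < b * d ^ N + d ^ N := by omega
        _ = (b + 1) * d ^ N := by ring
        _ ≤ d ^ l * d ^ N := Nat.mul_le_mul_right _ hb
        _ = d ^ (N + l) := by rw [pow_add, mul_comm]
    obtain ⟨c₀, i, hc₀, hi, hc⟩ := key N l _ hlt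
    obtain ⟨m, e, he, hfm⟩ := hf c₀ hc₀
    have hfm' := hfm.sub hi
    rw [add_comm l N, hc] at hmap'
    refine ⟨m + l, e * d ^ l + i, ?_, hmap'.comp hfm'⟩
    calc e * d ^ l + i < e * d ^ l + d ^ l := by omega
      _ = (e + 1) * d ^ l := by ring
      _ ≤ d ^ m * d ^ l := Nat.mul_le_mul_right _ he
      _ = d ^ (m + l) := (pow_add _ _ _).symm
  inv_mem' := by
    intro g hg
    obtain ⟨N, hg⟩ := isPiecewiseStandardAffine_iff.1 hg
    choose l b hb hmap using fun a : Fin (d ^ N) => hg a a.2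
    refine isPiecewiseStandardAffine_iff.2 ⟨Finset.univ.sup l, fun c hc => ?_⟩
    obtain ⟨a, ha, hmem⟩ := exists_cell (d := d) N (g.symm (leftEnd hc))
    have h1 := (hmap ⟨a, ha⟩).mem hmem
    rw [Equiv.apply_symm_apply] at h1
    obtain ⟨m, hm⟩ := Nat.exists_eq_add_of_le (Finset.le_sup (f := l) (Finset.mem_univ ⟨a, ha⟩))
    have h2 : (c : ℝ) / (d : ℝ) ^ (l ⟨a, ha⟩ + m) ∈ cell d (l ⟨a, ha⟩) (b ⟨a, ha⟩) := by
      rw [← hm]; exact h1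
    obtain ⟨j, hj, rfl⟩ := exists_sub_index h2
    refine ⟨N + m, a * d ^ m + j, ?_, ?_⟩
    · calc a * d ^ m + j < a * d ^ m + d ^ m := by omega
        _ = (a + 1) * d ^ m := by ring
        _ ≤ d ^ N * d ^ m := Nat.mul_le_mul_right _ ha
        _ = d ^ (N + m) := (pow_add _ _ _).symm
    · rw [hm]
      exact ((hmap ⟨a, ha⟩).symm ha).sub hj

/-- `x, y, z` are distinct and in cyclic (counterclockwise) order on the circle `[0, 1)`. -/
def CyclicLT (x y z : UnitIco) : Prop :=
  (x < y ∧ y < z) ∨ (y < z ∧ z < x) ∨ (z < x ∧ x < y)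

/-- The Higman–Thompson group `T_d`: the elements of `V_d` that preserve the cyclic order. -/
def T (d : ℕ) [NeZero d] : Subgroup (Equiv.Perm UnitIco) where
  carrier := {g | g ∈ V d ∧ ∀ x y z, CyclicLT x y z → CyclicLT (g x) (g y) (g z)}
  one_mem' := ⟨one_mem _, fun _ _ _ h => h⟩
  mul_mem' := fun hf hg => ⟨mul_mem hf.1 hg.1, fun x y z h => hf.2 _ _ _ (hg.2 x y z h)⟩
  inv_mem' := by
    intro g hg
    refine ⟨inv_mem hg.1, fun x y z h => ?_⟩
    have e : ∀ t, g (g⁻¹ t) = t := fun t => g.apply_symm_apply t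
    have h1 := hg.2 (g⁻¹ x) (g⁻¹ z) (g⁻¹ y)
    rw [e, e, e] at h1
    have inj : ∀ s t, g⁻¹ s = g⁻¹ t → s = t := fun s t hst => (g⁻¹).injective hst
    have i1 := inj x y
    have i2 := inj y z
    have i3 := inj z x
    generalize g⁻¹ x = x' at *
    generalize g⁻¹ y = y' at *
    generalize g⁻¹ z = z' at *
    unfold CyclicLT at *
    grind

/-- The subgroup of `G` of the elements that act as the identity on `[0, 1/d)`
(written `G_{[0, 1/d)}`). -/
abbrev fixLeft (d : ℕ) (G : Subgroup (Equiv.Perm UnitIco)) : Subgroup G :=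
  fixingSubgroup G {x : UnitIco | (x : ℝ) < 1 / (d : ℝ)}

/-- The subgroup of `G` of the elements that act as the identity on `[1/d, 1)`
(written `G_{[1/d, 1]}`). -/
abbrev fixRight (d : ℕ) (G : Subgroup (Equiv.Perm UnitIco)) : Subgroup G :=
  fixingSubgroup G {x : UnitIco | 1 / (d : ℝ) ≤ (x : ℝ)}

/-- The virtual centralizer of `H` in `G`: the `g` with finitely many conjugates `h⁻¹ g h`,
`h ∈ H`. -/
def virtualCentralizer {G : Type*} [Group G] (H : Subgroup G) : Set G :=
  {g | {x : G | ∃ h ∈ H, h⁻¹ * g * h = x}.Finite}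

end HigmanThompson

/-! ### Group von Neumann algebras -/

namespace GroupVN

variable {G : Type*} [Group G]

/-- The Hilbert space `ℓ²(G)`. -/
abbrev L2 (G : Type*) : Type _ := lp (fun _ : G => ℂ) 2

theorem memℓp_translate (g : G) (f : L2 G) :
    Memℓp (fun x => (f : G → ℂ) (g⁻¹ * x)) 2 := by
  have h := lp.memℓp f
  rw [memℓp_gen_iff (by norm_num)] at h ⊢
  exact (Equiv.mulLeft g⁻¹).summable_iff.2 h

/-- The left regular representation `(λ_g f)(x) = f (g⁻¹ x)` on `ℓ²(G)`; so `λ_g δ_h = δ_{gh}`. -/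
def leftRegular (g : G) : L2 G →ₗᵢ[ℂ] L2 G where
  toFun f := ⟨fun x => (f : G → ℂ) (g⁻¹ * x), memℓp_translate g f⟩
  map_add' _ _ := rfl
  map_smul' _ _ := rfl
  norm_map' f := by
    have hp : 0 < (2 : ENNReal).toReal := by norm_num
    rw [lp.norm_eq_tsum_rpow hp, lp.norm_eq_tsum_rpow hp]
    congr 1
    exact (Equiv.mulLeft g⁻¹).tsum_eq (fun x => ‖(f : G → ℂ) x‖ ^ (2 : ENNReal).toReal)

/-- The operator `λ_g` on `ℓ²(G)`. -/
def lam (g : G) : L2 G →L[ℂ] L2 G := (leftRegular g).toContinuousLinearMap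

/-- The von Neumann algebra `(S ∪ S*)''` generated by a set `S` of bounded operators. -/
def vonNeumannClosure {E : Type*} [NormedAddCommGroup E] [InnerProductSpace ℂ E] [CompleteSpace E]
    (S : Set (E →L[ℂ] E)) : VonNeumannAlgebra E where
  toStarSubalgebra :=
    StarSubalgebra.centralizer ℂ (StarSubalgebra.centralizer ℂ S : Set (E →L[ℂ] E))
  centralizer_centralizer' := by
    simp

/-- For `H ≤ G`, the von Neumann subalgebra `L(H) = {λ_h : h ∈ H}''` of `L(G) ⊆ B(ℓ²(G))`. -/
def subgroupVN (H : Subgroup G) : VonNeumannAlgebra (L2 G) :=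
  vonNeumannClosure (lam '' (H : Set G))

/-- The group von Neumann algebra `L(G) = {λ_g : g ∈ G}''`. -/
def groupVN (G : Type*) [Group G] : VonNeumannAlgebra (L2 G) := subgroupVN (⊤ : Subgroup G)

/-- The relative commutant `S' ∩ M`. -/
def relativeCommutant {E : Type*} [NormedAddCommGroup E] [InnerProductSpace ℂ E] [CompleteSpace E]
    (S : Set (E →L[ℂ] E)) (M : VonNeumannAlgebra E) : Set (E →L[ℂ] E) :=
  Set.centralizer S ∩ (M : Set (E →L[ℂ] E))

/-- `N` is bicentralized in `M`: `(N' ∩ M)' ∩ M = N`. -/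
def IsBicentralized {E : Type*} [NormedAddCommGroup E] [InnerProductSpace ℂ E] [CompleteSpace E]
    (N M : VonNeumannAlgebra E) : Prop :=
  relativeCommutant (relativeCommutant (N : Set (E →L[ℂ] E)) M) M = (N : Set (E →L[ℂ] E))

end GroupVN

end

/-!
Let `G` be `T_d` or `V_d`, let `s` be one of `[0, 1/d)`, `[1/d, 1)`, and let `H` be the pointwise
stabilizer of `s` in `G`. Suppose that `g ∈ G` moves a point `x ∉ s`. Elements of `V_d` are
continuous from the right, so some standard interval `J` disjoint from `s`, just to the right of
`x`, is disjoint from `g J`. If `h, k` are supported in `J`, then `h⁻¹ g h` and `k⁻¹ g k` send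
`y ∈ J` to `g h y` and `g k y`, so they differ unless `h = k`. Infinitely many elements of `T_d` are
supported in `J`: the powers of a copy in `J` of an element of the group `F_d`. Hence
`g` has infinitely many conjugates under `H`
(`virtualCentralizer_fixingSubgroup_subset`), and the virtual centralizer of `H` fixes the
complement of `s` pointwise. Conversely, elements with disjoint supports commute, and the
centralizer is contained in the virtual centralizer, so all the inclusions are equalities
(`centralizer_fixingSubgroup`).

For the von Neumann algebras, `L(H) ⊆ (L(H)' ∩ L(G))' ∩ L(G)` is formal. Let `K` be the centralizer
of `H` and let `y` belong to the right-hand side. Then `y` commutes with `λ_k` for `k ∈ K`, because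
these lie in `L(H)' ∩ L(G)`; so the Fourier coefficients of `y` are constant on `K`-conjugacy
classes and, being square summable, are supported in the virtual centralizer of `K`
(`mem_virtualCentralizer_of_coeff_ne_zero`). By the first part this is `H`, and an
element of `L(G)` with Fourier coefficients supported in `H` lies in `L(H)`
(`mem_subgroupVN_of_coeff`).
-/

open Filter Topology

noncomputable section

namespace HigmanThompson

/-! ### A non-trivial element supported in a given standard interval -/

/-- For `D ≥ 2`, a homeomorphism of `ℝ` supported in `[0, 1]`. On that interval its slopes are
`D`, `1`, `D⁻¹`, with breakpoints `(D - 1) / D ^ 2` and `1 / D`; for `D = 2` it is a standard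
generator of Thompson's group `F`. It is concave on `[0, 1]`, whence the description as a minimum;
the outer maximum with `t` makes it the identity outside `[0, 1]`. -/
def bump (D t : ℝ) : ℝ := max t (min (D * t) (min (t + (1 - D⁻¹) ^ 2) (1 - (1 - t) * D⁻¹)))

variable {D t : ℝ}

theorem bump_strictMono (hD : 2 ≤ D) : StrictMono (bump D) := by
  intro s t hst
  have hD0 : 0 < D := by linarith
  have hi : 0 < D⁻¹ := inv_pos.2 hD0
  refine max_lt_max hst (min_lt_min (mul_lt_mul_of_pos_left hst hD0)
    (min_lt_min (by linarith) ?_))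
  have := mul_lt_mul_of_pos_right hst hi
  linarith

theorem bump_of_nonpos (hD : 2 ≤ D) (ht : t ≤ 0) : bump D t = t :=
  max_eq_left ((min_le_left _ _).trans (by nlinarith))

theorem bump_of_one_le (hD : 2 ≤ D) (ht : 1 ≤ t) : bump D t = t := by
  refine max_eq_left ((min_le_right _ _).trans ((min_le_right _ _).trans ?_))
  have h1 : D⁻¹ ≤ 1 := inv_le_one_of_one_le₀ (by linarith)
  nlinarith

theorem bump_surjective (hD : 2 ≤ D) : Function.Surjective (bump D) := by
  refine Continuous.surjective (by unfold bump; fun_prop) ?_ ?_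
  · exact tendsto_atTop_mono (fun t => le_max_left _ _) tendsto_id
  · refine Tendsto.congr' ?_ tendsto_id
    filter_upwards [eventually_le_atBot 0] with t ht
    exact (bump_of_nonpos hD ht).symm

theorem bump_eq_mul (hD : 2 ≤ D) (h0 : 0 ≤ t) (h1 : t * D ^ 2 ≤ D - 1) : bump D t = D * t := by
  -- With `u = D⁻¹` and `w = D t` as variables the inequalities are polynomial.
  obtain ⟨u, rfl⟩ : ∃ u, D = u⁻¹ := ⟨D⁻¹, (inv_inv D).symm⟩
  have hu : 0 < u := inv_pos.1 (by linarith)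
  have hu2 : u ≤ 1 / 2 := by rw [le_inv_comm₀ (by norm_num) hu] at hD; linarith
  have h1' : t ≤ u - u ^ 2 := by
    have := mul_le_mul_of_nonneg_right h1 (sq_nonneg u)
    field_simp at this
    linarith
  have e : t = u * (u⁻¹ * t) := by field_simp
  unfold bump
  rw [inv_inv]
  generalize u⁻¹ * t = w at *
  have hw0 : 0 ≤ w := by by_contra h; nlinarith
  have hw : w ≤ 1 - u := by by_contra h; nlinarith
  rw [min_eq_left (le_min _ _), max_eq_right] <;> nlinarith

theorem bump_eq_add (hD : 2 ≤ D) (h0 : D - 1 ≤ t * D ^ 2) (h1 : t * D ^ 2 ≤ D) :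
    bump D t = t + (1 - D⁻¹) ^ 2 := by
  -- With `u = D⁻¹` and `w = D t` as variables the inequalities are polynomial.
  obtain ⟨u, rfl⟩ : ∃ u, D = u⁻¹ := ⟨D⁻¹, (inv_inv D).symm⟩
  have hu : 0 < u := inv_pos.1 (by linarith)
  have hu2 : u ≤ 1 / 2 := by rw [le_inv_comm₀ (by norm_num) hu] at hD; linarith
  have h0' : u - u ^ 2 ≤ t := by
    have := mul_le_mul_of_nonneg_right h0 (sq_nonneg u)
    field_simp at this
    linarith
  have h1' : t ≤ u := by
    have := mul_le_mul_of_nonneg_right h1 (sq_nonneg u)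
    field_simp at this
    linarith
  have e : t = u * (u⁻¹ * t) := by field_simp
  unfold bump
  rw [inv_inv]
  generalize u⁻¹ * t = w at *
  have hw0 : 1 - u ≤ w := by by_contra h; nlinarith
  have hw : w ≤ 1 := by by_contra h; nlinarith
  rw [min_eq_left (by nlinarith : t + (1 - u) ^ 2 ≤ 1 - (1 - t) * u), min_eq_right,
    max_eq_right] <;> nlinarith

theorem bump_eq_div (hD : 2 ≤ D) (h0 : D ≤ t * D ^ 2) (h1 : t ≤ 1) :
    bump D t = 1 - (1 - t) * D⁻¹ := by
  -- With `u = D⁻¹` and `w = D t` as variables the inequalities are polynomial.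
  obtain ⟨u, rfl⟩ : ∃ u, D = u⁻¹ := ⟨D⁻¹, (inv_inv D).symm⟩
  have hu : 0 < u := inv_pos.1 (by linarith)
  have hu2 : u ≤ 1 / 2 := by rw [le_inv_comm₀ (by norm_num) hu] at hD; linarith
  have h0' : u ≤ t := by
    have := mul_le_mul_of_nonneg_right h0 (sq_nonneg u)
    field_simp at this
    linarith
  have e : t = u * (u⁻¹ * t) := by field_simp
  unfold bump
  rw [inv_inv]
  generalize u⁻¹ * t = w at *
  have hw0 : 1 ≤ w := by by_contra h; nlinarith
  rw [min_eq_right (by nlinarith : 1 - (1 - t) * u ≤ t + (1 - u) ^ 2), min_eq_right,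
    max_eq_right] <;> nlinarith

theorem lt_bump_half (hD : 2 ≤ D) : 1 / 2 < bump D (1 / 2) := by
  have hi : D⁻¹ ≤ 1 / 2 := by
    rw [inv_le_comm₀ (by linarith) (by norm_num)]; linarith
  refine lt_max_of_lt_right (lt_min (by linarith) (lt_min ?_ ?_)) <;> nlinarith

/-- The function `bump d`, transported from `[0, 1)` to `cell d k a`. -/
def cellBump (d k a : ℕ) (x : ℝ) : ℝ := (a + bump d (x * (d : ℝ) ^ k - a)) / (d : ℝ) ^ k

variable {d k a : ℕ}

/-- In the affine coordinate of the cell, `cellBump` is `bump`. -/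
theorem cellBump_mul_sub [NeZero d] (x : ℝ) :
    cellBump d k a x * (d : ℝ) ^ k - a = bump d (x * (d : ℝ) ^ k - a) := by
  have hk : ((d : ℝ) ^ k) ≠ 0 := pow_ne_zero _ (Nat.cast_ne_zero.2 (NeZero.ne d))
  rw [cellBump, div_mul_cancel₀ _ hk]
  ring

theorem cellBump_strictMono [NeZero d] (hd : 2 ≤ d) : StrictMono (cellBump d k a) := by
  intro x y hxy
  have hk : (0 : ℝ) < (d : ℝ) ^ k := pow_pos (Nat.cast_pos.2 (NeZero.pos d)) k
  refine div_lt_div_of_pos_right ?_ hk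
  have := bump_strictMono (D := d) (by exact_mod_cast hd)
    (show x * (d : ℝ) ^ k - a < y * (d : ℝ) ^ k - a by nlinarith)
  linarith

theorem cellBump_surjective [NeZero d] (hd : 2 ≤ d) :
    Function.Surjective (cellBump d k a) := by
  intro y
  have hk : ((d : ℝ) ^ k) ≠ 0 := pow_ne_zero _ (Nat.cast_ne_zero.2 (NeZero.ne d))
  obtain ⟨t, ht⟩ := bump_surjective (D := d) (by exact_mod_cast hd) (y * (d : ℝ) ^ k - a)
  refine ⟨(t + a) / (d : ℝ) ^ k, ?_⟩
  rw [cellBump, div_mul_cancel₀ _ hk, add_sub_cancel_right, ht]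
  field_simp
  ring

theorem cellBump_of_notMem [NeZero d] (hd : 2 ≤ d) {x : ℝ} (hx : x ∉ cell d k a) :
    cellBump d k a x = x := by
  have hk : ((d : ℝ) ^ k) ≠ 0 := pow_ne_zero _ (Nat.cast_ne_zero.2 (NeZero.ne d))
  have hD : (2 : ℝ) ≤ d := by exact_mod_cast hd
  have e : bump d (x * (d : ℝ) ^ k - a) = x * (d : ℝ) ^ k - a := by
    rw [mem_cell, not_and, not_lt] at hx
    rcases le_total 0 (x * (d : ℝ) ^ k - a) with h | h
    · exact bump_of_one_le hD (hx h)
    · exact bump_of_nonpos hD h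
  rw [cellBump, e]
  field_simp
  ring

theorem cellBump_zero [NeZero d] (hd : 2 ≤ d) : cellBump d k a 0 = 0 := by
  rw [cellBump, bump_of_nonpos (by exact_mod_cast hd) (by simp)]
  simp

theorem cellBump_one [NeZero d] (hd : 2 ≤ d) (ha : a < d ^ k) : cellBump d k a 1 = 1 :=
  cellBump_of_notMem hd fun h => lt_irrefl _ (cell_subset ha h).2

/-- `cellBump d k a` as a permutation of `[0, 1)`. -/
def cellPerm [NeZero d] (hd : 2 ≤ d) (ha : a < d ^ k) : Equiv.Perm UnitIco :=
  Equiv.Perm.subtypePerm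
    ((cellBump_strictMono hd).orderIsoOfSurjective (cellBump d k a)
      (cellBump_surjective hd)).toEquiv (fun x => by
    have h := cellBump_strictMono (k := k) (a := a) hd
    have h0 := h.le_iff_le (a := 0) (b := x)
    have h1 := h.lt_iff_lt (a := x) (b := 1)
    rw [cellBump_zero hd] at h0
    rw [cellBump_one hd ha] at h1
    exact and_congr h0 h1)

variable [NeZero d] (hd : 2 ≤ d) (ha : a < d ^ k)

theorem coe_cellPerm (x : UnitIco) : (cellPerm hd ha x : ℝ) = cellBump d k a x := rfl

theorem cellPerm_strictMono : StrictMono (cellPerm hd ha) :=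
  fun _ _ h => cellBump_strictMono hd h

theorem cellPerm_of_notMem {x : UnitIco} (hx : (x : ℝ) ∉ cell d k a) : cellPerm hd ha x = x :=
  Subtype.ext (cellBump_of_notMem hd hx)

theorem exists_lt_cellPerm : ∃ x, x < cellPerm hd ha x := by
  have hk : (0 : ℝ) < (d : ℝ) ^ k := pow_pos (Nat.cast_pos.2 (NeZero.pos d)) k
  have e : ((a : ℝ) + 1 / 2) / (d : ℝ) ^ k * (d : ℝ) ^ k - a = 1 / 2 := by
    rw [div_mul_cancel₀ _ hk.ne']; ring
  have hm : ((a : ℝ) + 1 / 2) / (d : ℝ) ^ k ∈ cell d k a := by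
    rw [mem_cell, e]; norm_num
  refine ⟨⟨_, cell_subset ha hm⟩, ?_⟩
  rw [← Subtype.coe_lt_coe, coe_cellPerm]
  change _ < (a + bump d (_ * (d : ℝ) ^ k - a)) / (d : ℝ) ^ k
  rw [e]
  have := lt_bump_half (D := d) (by exact_mod_cast hd)
  exact div_lt_div_of_pos_right (by linarith) hk

/-- On the intervals of level `k + 2` the map is standard affine: with `j` the position of such an
interval within the cell, it multiplies by `d` for `j < d - 1`, translates for `j = d - 1`, and
divides by `d` for `j ≥ d`. -/
theorem cellPerm_mem_V : cellPerm hd ha ∈ V d := by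
  have hD : (2 : ℝ) ≤ d := by exact_mod_cast hd
  have hD0 : (d : ℝ) ≠ 0 := by linarith
  have hk : ((d : ℝ) ^ k) ≠ 0 := pow_ne_zero _ hD0
  refine isPiecewiseStandardAffine_iff.2 ⟨k + 2, fun c hc => ?_⟩
  have hq : c / d ^ 2 < d ^ k := by
    rw [Nat.div_lt_iff_lt_mul (by positivity), ← pow_add]; exact hc
  have hj : c % d ^ 2 < d ^ 2 := Nat.mod_lt _ (by positivity)
  have hcq : c = c / d ^ 2 * d ^ 2 + c % d ^ 2 := (Nat.div_add_mod' c _).symm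
  generalize c / d ^ 2 = q at hq hcq
  generalize c % d ^ 2 = j at hj hcq
  subst hcq
  by_cases hqa : q = a
  · subst hqa
    -- In the coordinate `t` of the cell, the subinterval is `[j / d ^ 2, (j + 1) / d ^ 2)`.
    have hx : ∀ x : UnitIco, (x : ℝ) ∈ cell d (k + 2) (q * d ^ 2 + j) → ∃ t : ℝ,
        x * (d : ℝ) ^ k - q = t ∧ (cellPerm hd ha x : ℝ) * (d : ℝ) ^ k - q = bump d t ∧
        (x : ℝ) * (d : ℝ) ^ (k + 2) - (q * d ^ 2 + j : ℕ) = t * (d : ℝ) ^ 2 - j ∧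
        (j : ℝ) ≤ t * (d : ℝ) ^ 2 ∧ t * (d : ℝ) ^ 2 < j + 1 := by
      intro x hx
      have e : (x : ℝ) * (d : ℝ) ^ (k + 2) - (q * d ^ 2 + j : ℕ)
          = (x * (d : ℝ) ^ k - q) * (d : ℝ) ^ 2 - j := by push_cast; ring
      rw [mem_cell, e] at hx
      refine ⟨_, rfl, ?_, e, by linarith, by linarith⟩
      rw [coe_cellPerm, cellBump_mul_sub]
    rcases lt_trichotomy (j + 1) d with h | h | h
    · refine ⟨k + 1, q * d + j, by rw [pow_succ]; nlinarith, fun x hxm => ?_⟩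
      obtain ⟨t, ht, hb, e, h1, h2⟩ := hx x hxm
      have hj1 : (j : ℝ) + 1 + 1 ≤ d := by exact_mod_cast h
      have h0 : 0 ≤ t := nonneg_of_mul_nonneg_left (j.cast_nonneg.trans h1) (by positivity)
      rw [bump_eq_mul hD h0 (by linarith)] at hb
      rw [e]
      push_cast
      linear_combination (d : ℝ) * hb
    · refine ⟨k + 2, q * d ^ 2 + (d - 1) * d, ?_, fun x hxm => ?_⟩
      · have : (d - 1) * d < d ^ 2 := by
          rw [sq]; exact Nat.mul_lt_mul_of_pos_right (by omega) (by omega)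
        rw [pow_add]
        nlinarith
      · obtain ⟨t, ht, hb, e, h1, h2⟩ := hx x hxm
        have hj1 : (j : ℝ) + 1 = d := by exact_mod_cast h
        rw [bump_eq_add hD (by linarith) (by linarith)] at hb
        rw [e]
        push_cast [Nat.cast_sub (by omega : 1 ≤ d)]
        have e2 : ((1 : ℝ) - (d : ℝ)⁻¹) * d = d - 1 := by field_simp
        linear_combination (d : ℝ) ^ 2 * hb + ((1 - (d : ℝ)⁻¹) * d + (d - 1)) * e2 + hj1
    · refine ⟨k + 3, q * d ^ 3 + (d - 1) * d ^ 2 + j, ?_, fun x hxm => ?_⟩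
      · have : (d - 1) * d ^ 2 + d ^ 2 = d ^ 3 := by
          rw [← Nat.succ_mul, Nat.succ_eq_add_one, Nat.sub_add_cancel (by omega)]; ring
        rw [pow_add]
        nlinarith [pow_pos (NeZero.pos d) 3]
      · obtain ⟨t, ht, hb, e, h1, h2⟩ := hx x hxm
        have hj1 : (d : ℝ) ≤ j := by exact_mod_cast (by omega : d ≤ j)
        have hj2 : (j : ℝ) + 1 ≤ (d : ℝ) ^ 2 := by exact_mod_cast hj
        have ht1 : t ≤ 1 := by
          by_contra h
          have : 0 < (d : ℝ) ^ 2 := by positivity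
          nlinarith
        rw [bump_eq_div hD (by linarith) ht1] at hb
        rw [e]
        push_cast [Nat.cast_sub (by omega : 1 ≤ d)]
        have e2 : (d : ℝ)⁻¹ * d = 1 := inv_mul_cancel₀ hD0
        linear_combination (d : ℝ) ^ 3 * hb - (1 - t) * (d : ℝ) ^ 2 * e2
  · refine ⟨k + 2, q * d ^ 2 + j, hc, fun x hxm => ?_⟩
    rw [cellPerm_of_notMem]
    intro hxa
    apply hqa
    have h1 := mem_cell.1 (mem_cell_sub hj hxm)
    have h2 := mem_cell.1 hxa
    have h3 : (q : ℝ) < a + 1 := by linarith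
    have h4 : (a : ℝ) < q + 1 := by linarith
    have h3' : q < a + 1 := by exact_mod_cast h3
    have h4' : a < q + 1 := by exact_mod_cast h4
    omega

theorem cellPerm_mem_T : cellPerm hd ha ∈ T d := by
  refine ⟨cellPerm_mem_V hd ha, fun x y z h => ?_⟩
  have h1 := cellPerm_strictMono hd ha
  exact h.imp (fun h => ⟨h1 h.1, h1 h.2⟩) (fun h => h.imp (fun h => ⟨h1 h.1, h1 h.2⟩)
    fun h => ⟨h1 h.1, h1 h.2⟩)

include hd ha in
/-- A monotone permutation moving a point to the right has infinite order. -/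
theorem infinite_supported_in_cell {G : Subgroup (Equiv.Perm UnitIco)} (hTG : T d ≤ G) :
    {h : G | ∀ x : UnitIco, (x : ℝ) ∉ cell d k a → h • x = x}.Infinite := by
  obtain ⟨x, hx⟩ := exists_lt_cellPerm hd ha
  have hit := (cellPerm_strictMono hd ha).strictMono_iterate_of_lt_map hx
  let h : G := ⟨cellPerm hd ha, hTG (cellPerm_mem_T hd ha)⟩
  refine Set.infinite_of_injective_forall_mem (f := fun n : ℕ => h ^ n) ?_ ?_
  · intro m n hmn
    refine hit.injective ?_
    have h1 : ∀ n, (cellPerm hd ha)^[n] x = (h ^ n) • x := fun n => by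
      rw [smul_iterate_apply (a := h) n x |>.symm]; rfl
    change (cellPerm hd ha)^[m] x = (cellPerm hd ha)^[n] x
    rw [h1, h1]
    exact congrArg (· • x) hmn
  · intro n y hy
    have : h • y = y := cellPerm_of_notMem hd ha hy
    exact MulAction.mem_stabilizer_iff.1 (pow_mem (MulAction.mem_stabilizer_iff.2 this) n)

/-! ### Virtual centralizers of pointwise stabilizers -/

theorem centralizer_subset_virtualCentralizer {G : Type*} [Group G] (H : Subgroup G) :
    (Subgroup.centralizer (H : Set G) : Set G) ⊆ virtualCentralizer H := by
  intro g hg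
  refine (Set.finite_singleton g).subset ?_
  rintro _ ⟨h, hh, rfl⟩
  rw [Set.mem_singleton_iff, mul_assoc, ← Subgroup.mem_centralizer_iff.1 hg h hh,
    inv_mul_cancel_left]

/-- Permutations with disjoint supports commute. -/
theorem fixingSubgroup_compl_le_centralizer {α : Type*} {G : Subgroup (Equiv.Perm α)}
    (s : Set α) :
    fixingSubgroup G sᶜ ≤ Subgroup.centralizer (fixingSubgroup G s : Set G) := by
  intro g hg
  refine Subgroup.mem_centralizer_iff.2 fun h hh => ?_
  have hd : Equiv.Perm.Disjoint (h : Equiv.Perm α) g := by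
    intro x
    by_cases hx : x ∈ s
    · exact Or.inl ((mem_fixingSubgroup_iff G).1 hh x hx)
    · exact Or.inr ((mem_fixingSubgroup_iff G).1 hg x hx)
  exact Subtype.ext hd.commute

/-- If `g` maps `J` off itself, then distinct elements supported in `J` conjugate `g` to distinct
elements. So an element of the virtual centralizer of the pointwise stabilizer of `s` cannot
displace a subset of `sᶜ` that supports infinitely many elements of `G`. -/
theorem notMem_virtualCentralizer_of_displaced {M α : Type*} [Group M] [MulAction M α]
    [FaithfulSMul M α] {s J : Set α} {g : M} (hJs : Disjoint J s)
    (hgJ : ∀ y ∈ J, g • y ∉ J) (hinf : {h : M | ∀ y ∉ J, h • y = y}.Infinite) :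
    g ∉ virtualCentralizer (fixingSubgroup M s) := by
  intro hfin
  refine hinf (Set.Finite.of_finite_image (f := fun h => h⁻¹ * g * h) (hfin.subset ?_) ?_)
  · rintro _ ⟨h, hh, rfl⟩
    exact ⟨h, (mem_fixingSubgroup_iff M).2 fun y hy =>
      hh y fun hyJ => Set.disjoint_left.1 hJs hyJ hy, rfl⟩
  · intro h hh k hk hhk
    refine FaithfulSMul.eq_of_smul_eq_smul (α := α) fun y => ?_
    by_cases hy : y ∈ J
    · have hJ : ∀ h : M, (∀ y ∉ J, h • y = y) → h • y ∈ J := fun h hh => by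
        by_contra hn
        have := hh _ hn
        rw [smul_left_cancel_iff] at this
        exact hn (by rwa [this])
      have key : ∀ h : M, (∀ y ∉ J, h • y = y) → (h⁻¹ * g * h) • y = g • h • y := fun h hh => by
        rw [mul_smul, mul_smul, inv_smul_eq_iff, hh _ (hgJ _ (hJ h hh))]
      have e : (h⁻¹ * g * h) • y = (k⁻¹ * g * k) • y := congrArg (· • y) hhk
      rw [key h hh, key k hk, smul_left_cancel_iff] at e
      exact e
    · rw [hh y hy, hk y hy]

variable {d : ℕ} [NeZero d]

theorem T_le_V : T d ≤ V d := fun _ h => h.1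

/-- The elements of `V_d` are continuous from the right. -/
theorem tendsto_of_mem_V {g : Equiv.Perm UnitIco} (hg : g ∈ V d) (x : UnitIco) :
    Tendsto g (𝓝[≥] x) (𝓝 (g x)) := by
  obtain ⟨N, hg⟩ := isPiecewiseStandardAffine_iff.1 hg
  obtain ⟨a, ha, hx⟩ := exists_cell (d := d) N x
  obtain ⟨l, b, -, hmap⟩ := hg a ha
  have hl : ((d : ℝ) ^ l) ≠ 0 := pow_ne_zero _ (Nat.cast_ne_zero.2 (NeZero.ne d))
  have hev : ∀ᶠ y : UnitIco in 𝓝[≥] x,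
      ((y : ℝ) * (d : ℝ) ^ N - a + b) / (d : ℝ) ^ l = g y := by
    have h1 : ∀ᶠ y : UnitIco in 𝓝[≥] x, (y : ℝ) < ((a : ℝ) + 1) / (d : ℝ) ^ N :=
      (continuous_subtype_val.tendsto x).mono_left nhdsWithin_le_nhds |>.eventually_lt_const hx.2
    filter_upwards [h1, self_mem_nhdsWithin] with y hy hxy
    have := hmap y ⟨hx.1.trans hxy, hy⟩
    rw [div_eq_iff hl]
    linarith
  rw [tendsto_subtype_rng]
  refine Tendsto.congr' hev ?_
  rw [← hev.self_of_nhdsWithin (Set.mem_Ici.2 le_rfl)]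
  exact (Continuous.tendsto (by fun_prop) x).mono_left nhdsWithin_le_nhds

/-- Every right neighbourhood contains a standard interval. -/
theorem exists_cell_subset_of_mem_nhdsGE (hd : 2 ≤ d) {x : UnitIco} {s : Set UnitIco}
    (hs : s ∈ 𝓝[≥] x) :
    ∃ k a, a < d ^ k ∧ ∀ y : UnitIco, (y : ℝ) ∈ cell d k a → y ∈ s := by
  obtain ⟨u, hxu, hu⟩ := mem_nhdsGE_iff_exists_Ico_subset.1 hs
  have hxu' : (x : ℝ) < u := hxu
  have hD : (1 : ℝ) < d := by exact_mod_cast hd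
  obtain ⟨k, hk⟩ := pow_unbounded_of_one_lt (2 / ((u : ℝ) - x)) hD
  have hd0 : (0 : ℝ) < (d : ℝ) ^ k := by positivity
  rw [div_lt_iff₀ (by linarith)] at hk
  -- The first grid point of level `k` not to the left of `x` starts an interval ending before `u`.
  have hc := Nat.le_ceil ((x : ℝ) * (d : ℝ) ^ k)
  have hc' := Nat.ceil_lt_add_one (mul_nonneg x.2.1 hd0.le)
  have hu1 : (u : ℝ) * (d : ℝ) ^ k < 1 * (d : ℝ) ^ k := mul_lt_mul_of_pos_right u.2.2 hd0
  refine ⟨k, ⌈(x : ℝ) * (d : ℝ) ^ k⌉₊, ?_, fun y hy => hu ⟨?_, ?_⟩⟩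
  · have : ((⌈(x : ℝ) * (d : ℝ) ^ k⌉₊ : ℕ) : ℝ) < ((d ^ k : ℕ) : ℝ) := by push_cast; linarith
    exact_mod_cast this
  · rw [mem_cell] at hy
    change (x : ℝ) ≤ y
    by_contra h
    nlinarith
  · rw [mem_cell] at hy
    change (y : ℝ) < u
    by_contra h
    nlinarith

/-- An element of `G` that moves a point outside `s` displaces, by continuity from the right, a
small standard interval to the right of that point. -/
theorem virtualCentralizer_fixingSubgroup_subset (hd : 2 ≤ d) {G : Subgroup (Equiv.Perm UnitIco)}
    (hTG : T d ≤ G) (hGV : G ≤ V d) {s : Set UnitIco} (hs : ∀ x ∉ s, sᶜ ∈ 𝓝[≥] x) :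
    virtualCentralizer (fixingSubgroup G s) ⊆ (fixingSubgroup G sᶜ : Set G) := by
  intro g hg
  refine (mem_fixingSubgroup_iff G).2 fun x hx => ?_
  by_contra hgx
  obtain ⟨U, W, hU, hW, hxU, hxW, hUW⟩ := t2_separation (Ne.symm hgx)
  have h1 : U ∈ 𝓝[≥] x := nhdsWithin_le_nhds (hU.mem_nhds hxU)
  have h2 : (fun y => g • y) ⁻¹' W ∈ 𝓝[≥] x :=
    tendsto_of_mem_V (hGV g.2) x (hW.mem_nhds hxW)
  obtain ⟨k, a, ha, hJ⟩ :=
    exists_cell_subset_of_mem_nhdsGE hd (inter_mem (hs x hx) (inter_mem h1 h2))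
  refine notMem_virtualCentralizer_of_displaced (J := {y : UnitIco | (y : ℝ) ∈ cell d k a})
    ?_ ?_ (infinite_supported_in_cell hd ha hTG) hg
  · exact Set.disjoint_left.2 fun y hy => (hJ y hy).1
  · exact fun y hy hgy => Set.disjoint_left.1 hUW (hJ _ hgy).2.1 (hJ y hy).2.2

theorem centralizer_fixingSubgroup (hd : 2 ≤ d) {G : Subgroup (Equiv.Perm UnitIco)}
    (hTG : T d ≤ G) (hGV : G ≤ V d) {s : Set UnitIco} (hs : ∀ x ∉ s, sᶜ ∈ 𝓝[≥] x) :
    virtualCentralizer (fixingSubgroup G s) =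
        Subgroup.centralizer (fixingSubgroup G s : Set G) ∧
      Subgroup.centralizer (fixingSubgroup G s : Set G) = fixingSubgroup G sᶜ := by
  have h1 := virtualCentralizer_fixingSubgroup_subset hd hTG hGV hs
  have h2 := fixingSubgroup_compl_le_centralizer (G := G) s
  have h3 := centralizer_subset_virtualCentralizer (fixingSubgroup G s)
  exact ⟨(h1.trans h2).antisymm h3, le_antisymm (h3.trans h1) h2⟩

theorem centralizer_fixLeft (hd : 2 ≤ d) {G : Subgroup (Equiv.Perm UnitIco)}
    (hTG : T d ≤ G) (hGV : G ≤ V d) :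
    virtualCentralizer (fixLeft d G) = Subgroup.centralizer (fixLeft d G : Set G) ∧
      Subgroup.centralizer (fixLeft d G : Set G) = fixRight d G := by
  have e : {x : UnitIco | (x : ℝ) < 1 / (d : ℝ)}ᶜ = {x : UnitIco | 1 / (d : ℝ) ≤ (x : ℝ)} := by
    ext x; simp
  have h := centralizer_fixingSubgroup hd hTG hGV (s := {x : UnitIco | (x : ℝ) < 1 / (d : ℝ)}) ?_
  · rwa [e] at h
  · intro x hx
    filter_upwards [self_mem_nhdsWithin] with y hy hyd
    exact hx (Set.mem_ofPred_eq ▸ lt_of_le_of_lt (Subtype.coe_le_coe.2 hy) hyd)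

theorem centralizer_fixRight (hd : 2 ≤ d) {G : Subgroup (Equiv.Perm UnitIco)}
    (hTG : T d ≤ G) (hGV : G ≤ V d) :
    virtualCentralizer (fixRight d G) = Subgroup.centralizer (fixRight d G : Set G) ∧
      Subgroup.centralizer (fixRight d G : Set G) = fixLeft d G := by
  have e : {x : UnitIco | 1 / (d : ℝ) ≤ (x : ℝ)}ᶜ = {x : UnitIco | (x : ℝ) < 1 / (d : ℝ)} := by
    ext x; simp
  have h := centralizer_fixingSubgroup hd hTG hGV (s := {x : UnitIco | 1 / (d : ℝ) ≤ (x : ℝ)}) ?_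
  · rwa [e] at h
  · intro x hx
    have hx' := Set.mem_compl hx
    rw [e] at hx' ⊢
    exact nhdsWithin_le_nhds ((isOpen_lt continuous_subtype_val continuous_const).mem_nhds hx')

end HigmanThompson

namespace GroupVN

/-! ### Fourier coefficients of elements of group von Neumann algebras -/

section

variable {E : Type*} [NormedAddCommGroup E] [InnerProductSpace ℂ E] [CompleteSpace E]
  {S : Set (E →L[ℂ] E)} {x : E →L[ℂ] E}

theorem mem_vonNeumannClosure_iff :
    x ∈ vonNeumannClosure S ↔ ∀ y ∈ StarSubalgebra.centralizer ℂ S, y * x = x * y := by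
  change x ∈ StarSubalgebra.centralizer ℂ (StarSubalgebra.centralizer ℂ S : Set (E →L[ℂ] E)) ↔ _
  rw [StarSubalgebra.mem_centralizer_iff]
  exact ⟨fun h y hy => (h y hy).1, fun h y hy => ⟨h y hy, h _ (star_mem hy)⟩⟩

theorem vonNeumannClosure_mono {S' : Set (E →L[ℂ] E)} (h : S ⊆ S')
    (hx : x ∈ vonNeumannClosure S) : x ∈ vonNeumannClosure S' := by
  rw [mem_vonNeumannClosure_iff] at hx ⊢
  intro y hy
  refine hx y ?_
  rw [StarSubalgebra.mem_centralizer_iff] at hy ⊢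
  exact fun s hs => hy s (h hs)

end

open Classical in
/-- The basis vector `δ_g` of `ℓ²(G)`. -/
def delta {G : Type*} (g : G) : L2 G := lp.single 2 g (1 : ℂ)

section

variable {G : Type*}

theorem delta_apply_self (g : G) : (delta g : G → ℂ) g = 1 := by
  simp [delta]

theorem delta_apply_of_ne {g h : G} (hgh : h ≠ g) : (delta g : G → ℂ) h = 0 := by
  simp [delta, hgh]

theorem hasSum_delta (f : L2 G) : HasSum (fun g => (f : G → ℂ) g • delta g) f := by
  classical
  have h := lp.hasSum_single (E := fun _ : G => ℂ) (p := 2) (by norm_num) f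
  convert h using 2 with g
  rw [delta, ← lp.single_smul, smul_eq_mul, mul_one]

/-- A bounded operator on `ℓ²(G)` acts through its matrix coefficients. -/
theorem hasSum_apply (y : L2 G →L[ℂ] L2 G) (f : L2 G) (b : G) :
    HasSum (fun c => (f : G → ℂ) c * (y (delta c) : G → ℂ) b) ((y f : G → ℂ) b) := by
  have h := (hasSum_delta f).mapL ((lp.evalCLM ℂ (fun _ : G => ℂ) 2 b).comp y)
  simp only [map_smul] at h
  exact h

theorem ext_delta {x y : L2 G →L[ℂ] L2 G} (h : ∀ a, x (delta a) = y (delta a)) : x = y := by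
  ext f b
  refine (hasSum_apply x f b).unique ?_
  simpa only [h] using hasSum_apply y f b

end

variable {G : Type*} [Group G]

theorem lam_apply (g : G) (f : L2 G) (a : G) : (lam g f : G → ℂ) a = (f : G → ℂ) (g⁻¹ * a) := rfl

theorem lam_delta (g a : G) : lam g (delta a) = delta (g * a) := by
  ext b
  rw [lam_apply]
  by_cases h : b = g * a
  · rw [h, inv_mul_cancel_left, delta_apply_self, delta_apply_self]
  · rw [delta_apply_of_ne h, delta_apply_of_ne]
    rintro rfl
    exact h (mul_inv_cancel_left g b).symm

theorem lam_mul (g h : G) : lam (g * h) = lam g * lam h :=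
  ext_delta fun a => by
    rw [mul_apply_eq_comp, lam_delta, lam_delta, lam_delta, mul_assoc]

theorem lam_one : lam (1 : G) = 1 :=
  ext_delta fun a => by rw [lam_delta, one_mul]; rfl

theorem star_lam (g : G) : star (lam g) = lam g⁻¹ := by
  have h1 : star (lam g) * lam g = 1 :=
    (ContinuousLinearMap.norm_map_iff_adjoint_comp_self _).1 (leftRegular g).norm_map
  calc star (lam g) = star (lam g) * (lam g * lam g⁻¹) := by
        rw [← lam_mul, mul_inv_cancel, lam_one, mul_one]
    _ = lam g⁻¹ := by rw [← mul_assoc, h1, one_mul]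

theorem mem_centralizer_lam_iff {H : Subgroup G} {y : L2 G →L[ℂ] L2 G} :
    y ∈ StarSubalgebra.centralizer ℂ (lam '' (H : Set G)) ↔ ∀ h ∈ H, lam h * y = y * lam h := by
  rw [StarSubalgebra.mem_centralizer_iff, Set.forall_mem_image]
  refine ⟨fun hy h hh => (hy hh).1, fun hy h hh => ⟨hy h hh, ?_⟩⟩
  rw [star_lam]
  exact hy _ (inv_mem hh)

theorem lam_mem_subgroupVN {H : Subgroup G} {h : G} (hh : h ∈ H) : lam h ∈ subgroupVN H :=
  mem_vonNeumannClosure_iff.2 fun _ hy => (mem_centralizer_lam_iff.1 hy h hh).symm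

theorem subgroupVN_le_groupVN {H : Subgroup G} {x : L2 G →L[ℂ] L2 G} (hx : x ∈ subgroupVN H) :
    x ∈ groupVN G :=
  vonNeumannClosure_mono (Set.image_mono (Set.subset_univ _)) hx

theorem memℓp_translate_right (g : G) (f : L2 G) :
    Memℓp (fun x => (f : G → ℂ) (x * g)) 2 := by
  have h := lp.memℓp f
  rw [memℓp_gen_iff (by norm_num)] at h ⊢
  exact (Equiv.mulRight g).summable_iff.2 h

/-- The operator `ρ_g` of the right regular representation `(ρ_g f)(x) = f (x g)`; so
`ρ_g δ_a = δ_{a g⁻¹}`. -/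
def rho (g : G) : L2 G →L[ℂ] L2 G :=
  LinearIsometry.toContinuousLinearMap
    { toFun := fun f => ⟨fun x => (f : G → ℂ) (x * g), memℓp_translate_right g f⟩
      map_add' := fun _ _ => rfl
      map_smul' := fun _ _ => rfl
      norm_map' := fun f => by
        have hp : 0 < (2 : ENNReal).toReal := by norm_num
        rw [lp.norm_eq_tsum_rpow hp, lp.norm_eq_tsum_rpow hp]
        congr 1
        exact (Equiv.mulRight g).tsum_eq (fun x => ‖(f : G → ℂ) x‖ ^ (2 : ENNReal).toReal) }

theorem rho_apply (g : G) (f : L2 G) (a : G) : (rho g f : G → ℂ) a = (f : G → ℂ) (a * g) := rfl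

theorem rho_delta (g : G) : rho g (delta g) = delta 1 := by
  ext b
  rw [rho_apply]
  by_cases h : b = 1
  · rw [h, one_mul, delta_apply_self, delta_apply_self]
  · rw [delta_apply_of_ne h, delta_apply_of_ne]
    simpa using h

theorem lam_mul_rho (g h : G) : lam g * rho h = rho h * lam g := by
  ext f a
  change (f : G → ℂ) (g⁻¹ * a * h) = (f : G → ℂ) (g⁻¹ * (a * h))
  rw [mul_assoc]

/-- The Fourier coefficient of `x` at `g`: for `x = ∑ x_g λ_g` it is `x_g`. -/
def coeff (x : L2 G →L[ℂ] L2 G) (g : G) : ℂ := (x (delta 1) : G → ℂ) g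

/-- Since it commutes with right translations, an element of `L(G)` has a matrix determined by its
Fourier coefficients. -/
theorem apply_delta_eq_coeff {x : L2 G →L[ℂ] L2 G} (hx : x ∈ groupVN G) (b c : G) :
    (x (delta c) : G → ℂ) b = coeff x (b * c⁻¹) := by
  have h := mem_vonNeumannClosure_iff.1 hx (rho c)
    (mem_centralizer_lam_iff.2 fun g _ => lam_mul_rho g c)
  have h2 : rho c (x (delta c)) = x (rho c (delta c)) := congrArg (· (delta c)) h
  rw [coeff, ← rho_delta c, ← h2, rho_apply, inv_mul_cancel_right]

/-- An element of `L(G)` whose Fourier coefficients are supported in `H` belongs to `L(H)`. -/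
theorem mem_subgroupVN_of_coeff {H : Subgroup G} {x : L2 G →L[ℂ] L2 G} (hx : x ∈ groupVN G)
    (hH : ∀ g, coeff x g ≠ 0 → g ∈ H) : x ∈ subgroupVN H := by
  refine mem_vonNeumannClosure_iff.2 fun y hy => ext_delta fun a => lp.ext (funext fun b => ?_)
  rw [mem_centralizer_lam_iff] at hy
  -- Both sides are the sum over `g` of `x_g (y δ_a)(g⁻¹ b)`; on the left only the `λ_g` with
  -- `g ∈ H` occur, and these may be moved past `y`.
  have h1 := hasSum_apply y (x (delta a)) b
  have h2 := hasSum_apply x (y (delta a)) b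
  refine h1.unique (a₂ := (x (y (delta a)) : G → ℂ) b) ?_
  let e : G ≃ G := (Equiv.mulRight a⁻¹).trans ((Equiv.inv G).trans (Equiv.mulRight b))
  rw [← e.hasSum_iff] at h2
  convert h2 using 2 with c
  have hec : e c = (c * a⁻¹)⁻¹ * b := rfl
  rw [Function.comp_apply, apply_delta_eq_coeff hx, apply_delta_eq_coeff hx, hec,
    show b * ((c * a⁻¹)⁻¹ * b)⁻¹ = c * a⁻¹ by group]
  by_cases h0 : coeff x (c * a⁻¹) = 0
  · rw [h0, zero_mul, mul_zero]
  · have h3 : lam (c * a⁻¹) (y (delta a)) = y (lam (c * a⁻¹) (delta a)) :=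
      congrArg (· (delta a)) (hy _ (hH _ h0))
    rw [lam_delta, inv_mul_cancel_right] at h3
    rw [← h3, lam_apply, mul_comm]

/-- The Fourier coefficients of an element that commutes with `λ(K)` are constant on `K`-conjugacy
classes; being square summable, they vanish on the infinite ones. -/
theorem mem_virtualCentralizer_of_coeff_ne_zero {K : Subgroup G} {x : L2 G →L[ℂ] L2 G}
    (hx : x ∈ groupVN G) (hK : ∀ k ∈ K, lam k * x = x * lam k) {g : G} (hg : coeff x g ≠ 0) :
    g ∈ HigmanThompson.virtualCentralizer K := by
  have hconj : ∀ k ∈ K, coeff x (k⁻¹ * g * k) = coeff x g := by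
    intro k hk
    have h : lam k (x (delta 1)) = x (lam k (delta 1)) := congrArg (· (delta 1)) (hK k hk)
    have h2 := apply_delta_eq_coeff hx (g * k) k
    rw [mul_inv_cancel_right] at h2
    rw [← h2, ← mul_one k, ← lam_delta, ← h, lam_apply, coeff, mul_one, mul_assoc]
  have hs := (memℓp_gen_iff (by norm_num)).1 (lp.memℓp (x (delta 1)))
  have hev := hs.tendsto_cofinite_zero.eventually_ne
    (b₂ := ‖coeff x g‖ ^ (2 : ENNReal).toReal)
    (Real.rpow_pos_of_pos (norm_pos_iff.2 hg) _).ne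
  refine Set.Finite.subset (Filter.eventually_cofinite.1 hev) ?_
  rintro _ ⟨k, hk, rfl⟩
  rw [Set.mem_ofPred_eq, not_not, ← hconj k hk]
  rfl

/-- If the virtual centralizer of the centralizer of `H` is no larger than `H`, then `L(H)` is
bicentralized in `L(G)`. -/
theorem isBicentralized_subgroupVN {H : Subgroup G}
    (hH : HigmanThompson.virtualCentralizer (Subgroup.centralizer (H : Set G)) ⊆ (H : Set G)) :
    IsBicentralized (subgroupVN H) (groupVN G) := by
  refine Set.Subset.antisymm ?_ ?_
  · rintro y ⟨hy, hyG⟩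
    -- `y` commutes with `λ_k` for `k` in the centralizer of `H`, since `λ_k ∈ L(H)' ∩ L(G)`.
    refine mem_subgroupVN_of_coeff hyG fun g hg => hH ?_
    refine mem_virtualCentralizer_of_coeff_ne_zero hyG (fun k hk => hy _ ⟨?_, ?_⟩) hg
    · intro z hz
      refine (mem_vonNeumannClosure_iff.1 hz (lam k) (mem_centralizer_lam_iff.2 ?_)).symm
      intro h hh
      rw [← lam_mul, ← lam_mul, Subgroup.mem_centralizer_iff.1 hk h hh]
    · exact subgroupVN_le_groupVN (lam_mem_subgroupVN hk)
  · exact fun y hy => ⟨fun z hz => (hz.1 y hy).symm, subgroupVN_le_groupVN hy⟩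

end GroupVN

end

theorem mainTheorem9 (d : ℕ) [NeZero d] (hd : 2 ≤ d) :
    (HigmanThompson.virtualCentralizer (HigmanThompson.fixLeft d (HigmanThompson.V d)) =
        Subgroup.centralizer (HigmanThompson.fixLeft d (HigmanThompson.V d) :
          Set (HigmanThompson.V d)) ∧
      Subgroup.centralizer (HigmanThompson.fixLeft d (HigmanThompson.V d) :
          Set (HigmanThompson.V d)) =
        HigmanThompson.fixRight d (HigmanThompson.V d)) ∧
    (HigmanThompson.virtualCentralizer (HigmanThompson.fixRight d (HigmanThompson.V d)) =
        Subgroup.centralizer (HigmanThompson.fixRight d (HigmanThompson.V d) :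
          Set (HigmanThompson.V d)) ∧
      Subgroup.centralizer (HigmanThompson.fixRight d (HigmanThompson.V d) :
          Set (HigmanThompson.V d)) =
        HigmanThompson.fixLeft d (HigmanThompson.V d)) ∧
    (HigmanThompson.virtualCentralizer (HigmanThompson.fixLeft d (HigmanThompson.T d)) =
        Subgroup.centralizer (HigmanThompson.fixLeft d (HigmanThompson.T d) :
          Set (HigmanThompson.T d)) ∧
      Subgroup.centralizer (HigmanThompson.fixLeft d (HigmanThompson.T d) :
          Set (HigmanThompson.T d)) =
        HigmanThompson.fixRight d (HigmanThompson.T d)) ∧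
    (HigmanThompson.virtualCentralizer (HigmanThompson.fixRight d (HigmanThompson.T d)) =
        Subgroup.centralizer (HigmanThompson.fixRight d (HigmanThompson.T d) :
          Set (HigmanThompson.T d)) ∧
      Subgroup.centralizer (HigmanThompson.fixRight d (HigmanThompson.T d) :
          Set (HigmanThompson.T d)) =
        HigmanThompson.fixLeft d (HigmanThompson.T d)) ∧
    GroupVN.IsBicentralized (GroupVN.subgroupVN (HigmanThompson.fixLeft d (HigmanThompson.V d)))
      (GroupVN.groupVN (HigmanThompson.V d)) ∧
    GroupVN.IsBicentralized (GroupVN.subgroupVN (HigmanThompson.fixLeft d (HigmanThompson.T d)))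
      (GroupVN.groupVN (HigmanThompson.T d)) := by 
  have hV := HigmanThompson.centralizer_fixLeft hd HigmanThompson.T_le_V le_rfl
  have hV' := HigmanThompson.centralizer_fixRight hd HigmanThompson.T_le_V le_rfl
  have hT := HigmanThompson.centralizer_fixLeft hd le_rfl HigmanThompson.T_le_V
  have hT' := HigmanThompson.centralizer_fixRight hd le_rfl HigmanThompson.T_le_V
  refine ⟨hV, hV', hT, hT', GroupVN.isBicentralized_subgroupVN ?_,
    GroupVN.isBicentralized_subgroupVN ?_⟩
  · rw [hV.2, hV'.1, hV'.2]
  · rw [hT.2, hT'.1, hT'.2]
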